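/- Let $d \ge 1$ be an integer and let $X = \omega\cdot d + 1$, the compact space of all ordinals $\le \omega\cdot d$ with the order topology. Let $M = \{\omega\cdot k : 1 \le k \le d\}$; for $0 \le k < d$ let $B_k = \{\omega\cdot k + \ell : \ell \in \mathbb{N},\ \ell \ge 1\}$, and let $N = \bigcup_{k<d} B_k$. Equip $\mathrm{Homeo}(X)$ with the compact-open topology. Let $\mathrm{F}_{0,d}$ be the subgroup of the homeomorphisms of $X$ that fix all but finitely many points of $N$, and let $\overline{\mathrm F}_{0,d}$ be its closure in $\mathrm{Homeo}(X)$, which is again a subgroup. For $f \in \overline{\mathrm F}_{0,d}$ let $Z_f$ be the set of all $\mu \in M$ such that every element $g$ of the cyclic group $\langle f\rangle$ fixes some open neighborhood of $\mu$ (depending on $g$) pointwise. Then for $f \in \overline{\mathrm F}_{0,d}$ the following are equivalent: (i) $f$ normally generates $\overline{\mathrm F}_{0,d}$, i.e. every element of $\overline{\mathrm F}_{0,d}$ is a product of conjugates (in $\overline{\mathrm F}_{0,d}$) of $f$ and $f^{-1}$; (ii) $f$ uniformly normally generates $\overline{\mathrm F}_{0,d}$, i.e. there is an integer $n \ge 1$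 such that every element of $\overline{\mathrm F}_{0,d}$ is a product of at most $n$ conjugates of $f$ and $f^{-1}$; (iii) $Z_f = \varnothing$; (iv) for each $k$ with $0 \le k < d$, $f$ induces an infinite permutation of $B_k$, in the sense that $f(B_k)$ and $B_k$ differ by only finitely many points and $f(x) \ne x$ for infinitely many $x \in B_k$. -/

import Mathlib

namespace OrdinalHomeo

open scoped Ordinal

section NormalGeneration

variable {G : Type*} [Group G]

/-- `y` is a conjugate of `g` or of `g⁻¹`. -/
def IsConjOrInv (g y : G) : Prop :=
  IsConj g y ∨ IsConj g⁻¹ y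

/-- Every element of `G` is a product of conjugates of `g` and `g⁻¹`. -/
def IsNormalGenerator (g : G) : Prop :=
  ∀ x : G, ∃ l : List G, (∀ y ∈ l, IsConjOrInv g y) ∧ l.prod = x

/-- For some `n ≥ 1`, every element of `G` is a product of at most `n` conjugates of `g` and
`g⁻¹`. -/
def IsUniformNormalGenerator (g : G) : Prop :=
  ∃ n : ℕ, 1 ≤ n ∧ ∀ x : G, ∃ l : List G,
    l.length ≤ n ∧ (∀ y ∈ l, IsConjOrInv g y) ∧ l.prod = x

end NormalGeneration

section HomeoTopology

variable {X : Type*} [TopologicalSpace X]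

/-- The compact-open topology on the homeomorphism group of `X`. -/
instance homeoCompactOpen : TopologicalSpace (X ≃ₜ X) :=
  TopologicalSpace.induced (fun h => (h : C(X, X))) ContinuousMap.compactOpen

theorem continuous_homeo_coe : Continuous (fun h : X ≃ₜ X => (h : C(X, X))) :=
  continuous_induced_dom

/-- The homeomorphism group of a compact Hausdorff space is a topological group. -/
instance homeoIsTopologicalGroup [CompactSpace X] [T2Space X] :
    IsTopologicalGroup (X ≃ₜ X) where
  continuous_mul := by
    refine continuous_induced_rng.2 ?_
    exact (continuous_homeo_coe.comp continuous_fst).compCM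
      (continuous_homeo_coe.comp continuous_snd)
  continuous_inv := by
    refine continuous_induced_rng.2 (ContinuousMap.continuous_compactOpen.2 ?_)
    intro K hK U hU
    have key : {h : X ≃ₜ X | Set.MapsTo ((h⁻¹ : X ≃ₜ X) : C(X, X)) K U} =
        (fun h : X ≃ₜ X => (h : C(X, X))) ⁻¹' {g | Set.MapsTo g Uᶜ Kᶜ} := by
      ext h
      constructor
      · intro H x hx hxK
        exact hx (by simpa using H hxK)
      · intro H x hx
        by_contra hxU
        have := H hxU
        apply this
        have : h (h⁻¹ x) = x := h.apply_symm_apply x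
        simpa [this] using hx
    exact key ▸ (ContinuousMap.isOpen_setOfPred_mapsTo hU.isClosed_compl.isCompact
      hK.isClosed.isOpen_compl).preimage continuous_homeo_coe

end HomeoTopology

/-- The ordinal `ω·d + 1`, as the space of all smaller ordinals with the order topology. -/
abbrev Space (d : ℕ) : Type 1 :=
  Set.Iio (ω * (d : Ordinal.{0}) + 1)

instance spaceCompact (d : ℕ) : CompactSpace (Space d) := by
  have h : Set.Iio (ω * (d : Ordinal.{0}) + 1) = Set.Icc 0 (ω * (d : Ordinal.{0})) := by
    ext x
    simp [← Order.succ_eq_add_one]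
  exact isCompact_iff_compactSpace.1 (h ▸ isCompact_Icc)

/-- The maximal rank points `ω·k`, `1 ≤ k ≤ d`. -/
def maxRank (d : ℕ) : Set (Space d) :=
  {x | ∃ k : ℕ, 1 ≤ k ∧ k ≤ d ∧ (x : Ordinal.{0}) = ω * k}

/-- The block `{ω·k + ℓ : ℓ ≥ 1}`. -/
def block (d k : ℕ) : Set (Space d) :=
  {x | ∃ l : ℕ, 1 ≤ l ∧ (x : Ordinal.{0}) = ω * k + l}

/-- The points `ω·k + ℓ` with `k < d` and `ℓ ≥ 1`: all isolated points except `0`. -/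
def nextRank (d : ℕ) : Set (Space d) :=
  ⋃ k ∈ Set.Iio d, block d k

/-- The homeomorphisms of `ω·d + 1` that induce a finite permutation of the isolated points,
i.e. that fix all but finitely many of them (one may or may not count the isolated point `0`). -/
def finitary (d : ℕ) : Subgroup (Space d ≃ₜ Space d) where
  carrier := {h | {x ∈ nextRank d | h x ≠ x}.Finite}
  one_mem' := by
    have : {x ∈ nextRank d | (1 : Space d ≃ₜ Space d) x ≠ x} = ∅ := by
      ext x
      simp
    simp only [Set.mem_ofPred_eq, this, Set.finite_empty]
  mul_mem' := by
    intro g h hg hh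
    refine (hg.union hh).subset ?_
    rintro x ⟨hx, hne⟩
    by_cases hxx : h x = x
    · left
      refine ⟨hx, fun hgx => hne ?_⟩
      change g (h x) = x
      rw [hxx, hgx]
    · exact Or.inr ⟨hx, hxx⟩
  inv_mem' := by
    intro h hh
    refine hh.subset ?_
    rintro x ⟨hx, hne⟩
    refine ⟨hx, fun hxx => hne ?_⟩
    change h.symm x = x
    rw [Homeomorph.symm_apply_eq, hxx]

/-- The closure of the finitary homeomorphisms in the compact-open topology. -/
def finitaryClosure (d : ℕ) : Subgroup (Space d ≃ₜ Space d) :=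
  (finitary d).topologicalClosure

/-- For a subgroup `Γ`, the set of the maximal rank points `μ` such that every `g ∈ Γ` fixes some
open neighbourhood of `μ` pointwise. -/
def trivialGermSet {d : ℕ} (Γ : Subgroup (finitaryClosure d)) : Set (Space d) :=
  {μ | μ ∈ maxRank d ∧ ∀ g ∈ Γ, ∃ U : Set (Space d), IsOpen U ∧ μ ∈ U ∧ ∀ x ∈ U, g.1 x = x}

/-- `h` induces an infinite permutation of `S`: it preserves `S` up to finitely many points and
moves infinitely many points of `S`. (An element of the closure of the finitary homeomorphisms may
exchange finitely many points between different blocks, so it need not preserve a block exactly.) -/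
def InducesInfinitePerm {d : ℕ} (h : Space d ≃ₜ Space d) (S : Set (Space d)) : Prop :=
  (symmDiff (h '' S) S).Finite ∧ {x ∈ S | h x ≠ x}.Infinite

end OrdinalHomeo

/-! Cut `X` into `d` pieces, each a block with its limit point (the point `0` joins the first
piece). Neighbourhoods of a limit point contain almost all of its piece, so germs at limit points
record behaviour up to finitely many points; this links (iii) and (iv). The group fixes every limit
point, so trivial germs at one of them form a proper normal subgroup, which a normal generator must
avoid.

For (iv) ⇒ (ii), pick in each piece an infinite set `Y` disjoint from its image under `f`, with that
image in the same piece. If `t` and `s` are supported in these sets, `f * t * f⁻¹` commutes with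
both, so a commutator of `t⁻¹` and `s` is a product of four conjugates of `f` and `f⁻¹`
(`isConjWord_commutator`). Every permutation of `ℕ` is a product of two conjugates of such
commutators (`exists_mul_conj_commutator`). Doing this in all pieces at once, every piece-preserving
element has length at most 8. A general element is a finitary one times a piece-preserving one, and
the finitary factor is conjugate to a piece-preserving element; hence the bound 16, independent of
`d`. -/

namespace OrdinalHomeo

open Equiv

/-! ### Products of conjugates and the double commutator trick. -/

section Words

variable {G : Type*} [Group G]

/-- `x` is a product of at most `n` conjugates of `g` and `g⁻¹`. -/
def IsConjWord (g : G) (n : ℕ) (x : G) : Prop :=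
  ∃ l : List G, l.length ≤ n ∧ (∀ y ∈ l, IsConjOrInv g y) ∧ l.prod = x

theorem isConjWord_conj (g c : G) : IsConjWord g 1 (c * g * c⁻¹) :=
  ⟨[c * g * c⁻¹], by simp, List.forall_mem_singleton.2 (Or.inl (isConj_iff.2 ⟨c, rfl⟩)), by simp⟩

theorem isConjWord_conj_inv (g c : G) : IsConjWord g 1 (c * g⁻¹ * c⁻¹) :=
  ⟨[c * g⁻¹ * c⁻¹], by simp, List.forall_mem_singleton.2 (Or.inr (isConj_iff.2 ⟨c, rfl⟩)), by simp⟩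

theorem IsConjWord.mul {g x y : G} {m n : ℕ} (hx : IsConjWord g m x) (hy : IsConjWord g n y) :
    IsConjWord g (m + n) (x * y) := by
  obtain ⟨l, h1, h2, rfl⟩ := hx
  obtain ⟨k, h3, h4, rfl⟩ := hy
  refine ⟨l ++ k, by simp; omega, ?_, by simp⟩
  intro z hz
  rcases List.mem_append.1 hz with hz | hz
  exacts [h2 z hz, h4 z hz]

theorem IsConjOrInv.conj {g y : G} (h : IsConjOrInv g y) (c : G) :
    IsConjOrInv g (c * y * c⁻¹) :=
  h.imp (fun h => h.trans (isConj_iff.2 ⟨c, rfl⟩)) (fun h => h.trans (isConj_iff.2 ⟨c, rfl⟩))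

theorem IsConjWord.conj {g x : G} {n : ℕ} (hx : IsConjWord g n x) (c : G) :
    IsConjWord g n (c * x * c⁻¹) := by
  obtain ⟨l, h1, h2, rfl⟩ := hx
  refine ⟨l.map (MulAut.conj c), by simpa using h1, ?_, ?_⟩
  · intro y hy
    obtain ⟨z, hz, rfl⟩ := List.mem_map.1 hy
    exact (h2 z hz).conj c
  · rw [← map_list_prod, MulAut.conj_apply]

/-- If the conjugate of `t` by `f` commutes with `s` and `t`, then `[t⁻¹, s]` is the double
commutator `[[f, t], s]`, a product of four conjugates of `f` and `f⁻¹`. -/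
theorem isConjWord_commutator {f t s : G} (ht : Commute (f * t * f⁻¹) t)
    (hs : Commute (f * t * f⁻¹) s) : IsConjWord f 4 (t⁻¹ * s * t * s⁻¹) := by
  have key : t⁻¹ * s * t * s⁻¹ = (1 * f * 1⁻¹) * (t * f⁻¹ * t⁻¹) *
      ((s * t) * f * (s * t)⁻¹) * (s * f⁻¹ * s⁻¹) := by
    set r := f * t * f⁻¹ with hr
    have h1 : f * t * f⁻¹ * t⁻¹ = t⁻¹ * r := (ht.inv_right).eq
    have h2 : (1 * f * 1⁻¹) * (t * f⁻¹ * t⁻¹) * ((s * t) * f * (s * t)⁻¹) * (s * f⁻¹ * s⁻¹) =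
        (f * t * f⁻¹ * t⁻¹) * s * (f * t * f⁻¹ * t⁻¹)⁻¹ * s⁻¹ := by group
    rw [h2, h1]
    have h3 : t⁻¹ * r * s * (t⁻¹ * r)⁻¹ * s⁻¹ = t⁻¹ * (r * s) * r⁻¹ * t * s⁻¹ := by group
    rw [h3, hs.eq]
    group
  rw [key]
  exact (((isConjWord_conj f 1).mul (isConjWord_conj_inv f t)).mul
    (isConjWord_conj f (s * t))).mul (isConjWord_conj_inv f s)

end Words

/-! ### Permutations of a countable set as products of commutators. -/

section Permutations

/-- An injection that moves every point of an infinite set maps some infinite subset off itself. -/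
theorem exists_infinite_subset_disjoint_image {α : Type*} {f : α → α}
    (hf : Function.Injective f) {D : Set α} (hD : D.Infinite) (hmove : ∀ x ∈ D, f x ≠ x) :
    ∃ Y ⊆ D, Y.Infinite ∧ ∀ x ∈ Y, f x ∉ Y := by
  classical
  obtain ⟨y, hy1, hy2⟩ := exists_seq_of_forall_finset_exists (fun x => x ∈ D)
    (fun x z => x ≠ z ∧ f x ≠ z ∧ f z ≠ x) (by
      intro s _
      -- Greedy choice: the next point avoids the earlier points, their images and their preimages.
      have hfin : ((s : Set α) ∪ f '' s ∪ f ⁻¹' s).Finite :=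
        ((s.finite_toSet).union (s.finite_toSet.image f)).union
          (s.finite_toSet.preimage hf.injOn)
      obtain ⟨z, hz, hzn⟩ := (hD.sdiff hfin).nonempty
      refine ⟨z, hz, fun x hx => ⟨?_, ?_, ?_⟩⟩
      · rintro rfl
        exact hzn (Or.inl (Or.inl hx))
      · rintro rfl
        exact hzn (Or.inl (Or.inr ⟨x, hx, rfl⟩))
      · rintro rfl
        exact hzn (Or.inr hx))
  have hne : ∀ a b, a ≠ b → y a ≠ y b ∧ f (y a) ≠ y b := by
    intro a b hab
    rcases lt_or_gt_of_ne hab with h | h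
    · exact ⟨(hy2 a b h).1, (hy2 a b h).2.1⟩
    · exact ⟨(hy2 b a h).1.symm, (hy2 b a h).2.2⟩
  refine ⟨Set.range y, Set.range_subset_iff.2 hy1, Set.infinite_range_of_injective ?_, ?_⟩
  · intro a b hab
    by_contra h
    exact (hne a b h).1 hab
  · rintro _ ⟨a, rfl⟩ ⟨b, hb⟩
    by_cases h : a = b
    · subst h
      exact hmove _ (hy1 a) hb.symm
    · exact (hne a b h).2 hb.symm

/-- An infinite set of natural numbers is the disjoint union of two infinite sets. -/
theorem exists_infinite_subset_infinite_diff {S : Set ℕ} (hS : S.Infinite) :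
    ∃ T ⊆ S, T.Infinite ∧ (S \ T).Infinite := by
  have := hS.to_subtype
  obtain ⟨e⟩ : Nonempty (ℕ ⊕ ℕ ≃ S) := nonempty_equiv_of_countable
  refine ⟨Set.range fun n => (e (Sum.inl n) : ℕ), ?_, ?_, ?_⟩
  · rintro _ ⟨n, rfl⟩
    exact (e (Sum.inl n)).2
  · exact Set.infinite_range_of_injective fun a b h => by simpa [Subtype.ext_iff.symm] using h
  · refine (Set.infinite_range_of_injective (f := fun n => (e (Sum.inr n) : ℕ))
      fun a b h => by simpa [Subtype.ext_iff.symm] using h).mono ?_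
    rintro _ ⟨n, rfl⟩
    refine ⟨(e (Sum.inr n)).2, ?_⟩
    rintro ⟨k, hk⟩
    simpa using e.injective (Subtype.ext hk)

/-- Every permutation of `ℕ` is a product of two permutations with infinitely many fixed points. -/
theorem exists_mul_of_infinite_fixed (σ : Perm ℕ) :
    ∃ τ ρ : Perm ℕ, {x | τ x = x}.Infinite ∧ {x | ρ x = x}.Infinite ∧ σ = τ * ρ := by
  classical
  by_cases hfix : {x | σ x = x}.Infinite
  · exact ⟨σ, 1, hfix, by simpa using Set.infinite_univ, by simp⟩
  have hmov : {x | σ x ≠ x}.Infinite := (Set.not_infinite.1 hfix).infinite_compl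
  obtain ⟨Y, -, hYi, hYd⟩ := exists_infinite_subset_disjoint_image σ.injective hmov fun _ h => h
  obtain ⟨T, hTY, hTi, hTd⟩ := exists_infinite_subset_infinite_diff hYi
  have hT : ∀ x ∈ T, σ x ∉ T := fun x hx h => hYd x (hTY hx) (hTY h)
  -- `g` swaps `x` and `σ x` for `x ∈ T`. It fixes `Y \ T`, and `g⁻¹ * σ` fixes `T`.
  let g : ℕ → ℕ := fun x => if x ∈ T then σ x else if σ.symm x ∈ T then σ.symm x else x
  have hg : Function.Involutive g := by
    intro x
    by_cases h1 : x ∈ T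
    · simp [g, h1, hT x h1]
    · by_cases h2 : σ.symm x ∈ T
      · simp [g, h1, h2]
      · simp [g, h1, h2]
  refine ⟨hg.toPerm g, (hg.toPerm g)⁻¹ * σ, ?_, ?_, by simp⟩
  · refine hTd.mono ?_
    rintro x ⟨hxY, hxT⟩
    have h2 : σ.symm x ∉ T := fun h => hYd _ (hTY h) (by simpa using hxY)
    simp only [Set.mem_ofPred_eq]
    change g x = x
    simp only [g, hxT, h2, if_false]
  · refine hTi.mono fun x hx => ?_
    have : hg.toPerm g x = σ x := by
      change g x = σ x
      simp only [g, hx, if_true]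
    simp only [Set.mem_ofPred_eq, Perm.mul_apply]
    rw [← this]
    exact (hg.toPerm g).symm_apply_apply x

/-- Two injections of `ℕ` into itself with infinite complements of their ranges differ by
a permutation. -/
theorem exists_perm_comp_eq {a b : ℕ → ℕ} (ha : Function.Injective a)
    (hb : Function.Injective b) (ha' : (Set.range a)ᶜ.Infinite) (hb' : (Set.range b)ᶜ.Infinite) :
    ∃ c : Perm ℕ, ∀ n, c (a n) = b n := by
  classical
  have := ha'.to_subtype
  have := hb'.to_subtype
  obtain ⟨e⟩ : Nonempty (↥(Set.range a)ᶜ ≃ ↥(Set.range b)ᶜ) := nonempty_equiv_of_countable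
  let e₀ : ↥(Set.range a) ≃ ↥(Set.range b) := (ofInjective a ha).symm.trans (ofInjective b hb)
  refine ⟨(Set.sumCompl (Set.range a)).symm.trans
    ((sumCongr e₀ e).trans (Set.sumCompl (Set.range b))), fun n => ?_⟩
  have h : (Set.sumCompl (Set.range a)).symm (a n) = Sum.inl ⟨a n, n, rfl⟩ :=
    Set.sumCompl_symm_apply_of_mem (Set.mem_range_self n)
  have h0 : (ofInjective a ha).symm ⟨a n, n, rfl⟩ = n := ofInjective_symm_apply ha n
  simp [h, e₀, h0]

/-- The permutation of `ℤ × ℕ` acting on the slices over `J` by `σ`. -/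
noncomputable def slicePerm (J : Set ℤ) (σ : Perm ℕ) : Perm (ℤ × ℕ) :=
  open Classical in prodShear (Equiv.refl ℤ) fun j => if j ∈ J then σ else 1

theorem slicePerm_apply_of_mem {J : Set ℤ} {j : ℤ} (h : j ∈ J) (σ : Perm ℕ) (n : ℕ) :
    slicePerm J σ (j, n) = (j, σ n) := by
  simp [slicePerm, h]

theorem slicePerm_apply_of_notMem {J : Set ℤ} {j : ℤ} (h : j ∉ J) (σ : Perm ℕ) (n : ℕ) :
    slicePerm J σ (j, n) = (j, n) := by
  simp [slicePerm, h]

/-- A permutation of one slice is the commutator of a permutation of a half space with the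
shift. -/
theorem exists_commutator_eq_slicePerm (σ : Perm ℕ) :
    ∃ t s : Perm (ℤ × ℕ), t⁻¹ * s * t * s⁻¹ = slicePerm {0} σ := by
  -- `t⁻¹` acts by `σ` on the slices `j ≥ 0`, and `s * t * s⁻¹` by `σ⁻¹` on the slices `j ≥ 1`; only
  -- slice `0` survives.
  refine ⟨slicePerm (Set.Ici 0) σ⁻¹, prodCongr (Equiv.addRight 1) (Equiv.refl ℕ), ?_⟩
  set t := slicePerm (Set.Ici 0) σ⁻¹
  set s : Perm (ℤ × ℕ) := prodCongr (Equiv.addRight 1) (Equiv.refl ℕ)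
  rw [mul_inv_eq_iff_eq_mul, mul_assoc, inv_mul_eq_iff_eq_mul]
  ext1 ⟨j, n⟩
  have hs : ∀ j n, s (j, n) = (j + 1, n) := fun j n => rfl
  simp only [Perm.mul_apply]
  rw [hs j n]
  -- With `s⁻¹` moved to the other side, the point enters slice `j + 1`, so the critical slice `0`
  -- is `j = -1`.
  rcases lt_trichotomy j (-1) with h | rfl | h
  · rw [slicePerm_apply_of_notMem (J := Set.Ici 0) (by simp; omega), hs,
      slicePerm_apply_of_notMem (J := {0}) (by simp; omega),
      slicePerm_apply_of_notMem (J := Set.Ici 0) (by simp; omega)]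
  · rw [slicePerm_apply_of_notMem (J := Set.Ici 0) (by simp), hs,
      slicePerm_apply_of_mem (J := {0}) (by simp),
      slicePerm_apply_of_mem (J := Set.Ici 0) (by simp)]
    simp
  · rw [slicePerm_apply_of_mem (J := Set.Ici 0) (by simp; omega), hs,
      slicePerm_apply_of_notMem (J := {0}) (by simp; omega),
      slicePerm_apply_of_mem (J := Set.Ici 0) (by simp; omega)]

/-- A permutation of `ℕ` with infinitely many fixed points is conjugate to a commutator of
permutations supported in a given infinite set. -/
theorem exists_conj_commutator {Y : Set ℕ} (hY : Y.Infinite) {σ : Perm ℕ}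
    (hσ : {x | σ x = x}.Infinite) :
    ∃ c t s : Perm ℕ, (∀ x ∉ Y, t x = x) ∧ (∀ x ∉ Y, s x = x) ∧
      σ = c * (t⁻¹ * s * t * s⁻¹) * c⁻¹ := by
  classical
  have := hY.to_subtype
  obtain ⟨u⟩ : Nonempty (ℤ × ℕ ≃ Y) := nonempty_equiv_of_countable
  -- Only half of the fixed points go into `T`: the complement, where `σ` may act nontrivially, must
  -- be infinite to be a copy of `ℕ`.
  obtain ⟨T, hTfix, hTi, hTd⟩ := exists_infinite_subset_infinite_diff hσ
  have hS : (Tᶜ).Infinite := hTd.mono fun x hx => hx.2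
  have := hS.to_subtype
  obtain ⟨θ⟩ : Nonempty (ℕ ≃ ↥(Tᶜ)) := nonempty_equiv_of_countable
  have hinv : ∀ x, x ∉ T ↔ σ x ∉ T := by
    intro x
    refine not_congr ⟨fun h => ?_, fun h => ?_⟩
    · rwa [show σ x = x from hTfix h]
    · have : σ (σ x) = σ x := hTfix h
      rwa [σ.injective this] at h
  let σ' : Perm ℕ :=
    (θ.trans (σ.subtypePerm (p := fun x => x ∈ Tᶜ) fun x => (hinv x).symm)).trans θ.symm
  have hσ' : ∀ n, (θ (σ' n) : ℕ) = σ (θ n) := by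
    intro n
    simp [σ']
  have hu : Function.Injective fun z => (u z : ℕ) := Subtype.val_injective.comp u.injective
  -- `c` carries slice `0` of `Y` onto the complement of `T`, hence everything else into `T`. Slice
  -- `1` and `T` witness that the complements of the two ranges are infinite.
  obtain ⟨c, hc⟩ := exists_perm_comp_eq (a := fun n => (u (0, n) : ℕ))
    (b := fun n => (θ n : ℕ)) (fun a b h => by simpa using hu h)
    (Subtype.val_injective.comp θ.injective)
    ((Set.infinite_range_of_injective (f := fun n => (u (1, n) : ℕ))
      fun a b h => by simpa using hu h).mono (by
        rintro _ ⟨n, rfl⟩ ⟨k, hk⟩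
        simpa using hu hk))
    (hTi.mono (by
      rintro x hx ⟨k, rfl⟩
      exact (θ k).2 hx))
  obtain ⟨t, s, hts⟩ := exists_commutator_eq_slicePerm σ'
  refine ⟨c, t.extendDomain u, s.extendDomain u,
    fun x hx => Perm.extendDomain_apply_not_subtype _ _ hx,
    fun x hx => Perm.extendDomain_apply_not_subtype _ _ hx, ?_⟩
  rw [Perm.extendDomain_inv, Perm.extendDomain_mul, Perm.extendDomain_mul, Perm.extendDomain_inv,
    Perm.extendDomain_mul, hts, eq_mul_inv_iff_mul_eq]
  ext y
  simp only [Perm.mul_apply]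
  by_cases hy : y ∈ Y
  · obtain ⟨⟨j, n⟩, hjn⟩ := u.surjective ⟨y, hy⟩
    obtain rfl : (u (j, n) : ℕ) = y := by rw [hjn]
    rw [Perm.extendDomain_apply_image]
    by_cases hj : j = 0
    · subst hj
      rw [slicePerm_apply_of_mem (Set.mem_singleton 0), hc, hc, hσ']
    · rw [slicePerm_apply_of_notMem (J := {0}) hj]
      refine hTfix ?_
      by_contra hn
      obtain ⟨k, hk⟩ := θ.surjective ⟨_, hn⟩
      have : c (u (j, n)) = c (u (0, k)) := by rw [hc, hk]
      have := hu (c.injective this)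
      simp at this
      exact hj this.1
  · rw [Perm.extendDomain_apply_not_subtype _ _ hy]
    refine hTfix ?_
    by_contra hn
    obtain ⟨k, hk⟩ := θ.surjective ⟨_, hn⟩
    have : c y = c (u (0, k)) := by rw [hc, hk]
    rw [c.injective this] at hy
    exact hy (u (0, k)).2

/-- Every permutation of `ℕ` is a product of two conjugates of commutators of permutations
supported in a given infinite set. -/
theorem exists_mul_conj_commutator {Y : Set ℕ} (hY : Y.Infinite) (σ : Perm ℕ) :
    ∃ c t s c' t' s' : Perm ℕ, (∀ x ∉ Y, t x = x) ∧ (∀ x ∉ Y, s x = x) ∧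
      (∀ x ∉ Y, t' x = x) ∧ (∀ x ∉ Y, s' x = x) ∧
      σ = c * (t⁻¹ * s * t * s⁻¹) * c⁻¹ * (c' * (t'⁻¹ * s' * t' * s'⁻¹) * c'⁻¹) := by
  obtain ⟨τ, ρ, hτ, hρ, rfl⟩ := exists_mul_of_infinite_fixed σ
  obtain ⟨c, t, s, ht, hs, h⟩ := exists_conj_commutator hY hτ
  obtain ⟨c', t', s', ht', hs', h'⟩ := exists_conj_commutator hY hρ
  exact ⟨c, t, s, c', t', s', ht, hs, ht', hs', by rw [← h, ← h']⟩

end Permutations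

end OrdinalHomeo

/-! ### Topology of spaces partitioned into pieces with one limit point each. -/

namespace OrdinalHomeo

open Equiv Filter Topology

/-- A partition of `X` into infinite open sets, the fibers of `p`, each with a distinguished point
`m i` such that all other points are isolated. -/
structure LimitPartition (X ι : Type*) [TopologicalSpace X] where
  /-- The index of the piece that contains a point. -/
  p : X → ι
  /-- The distinguished points. -/
  m : ι → X
  p_m : ∀ i, p (m i) = i
  isOpen_fiber : ∀ i, IsOpen (p ⁻¹' {i})
  isOpen_singleton : ∀ x, x ≠ m (p x) → IsOpen {x}
  infinite_fiber : ∀ i, (p ⁻¹' {i}).Infinite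

/-- The homeomorphisms that fix a neighbourhood of `μ` pointwise. -/
def germSubgroup {X : Type*} [TopologicalSpace X] (μ : X) : Subgroup (X ≃ₜ X) where
  carrier := {h | ∀ᶠ x in 𝓝 μ, h x = x}
  one_mem' := Eventually.of_forall fun _ => rfl
  mul_mem' := by
    intro g h hg hh
    filter_upwards [hg, hh] with x hgx hhx
    change g (h x) = x
    rw [hhx, hgx]
  inv_mem' := by
    intro h hh
    filter_upwards [hh] with x hx
    exact h.symm_apply_eq.2 hx.symm

theorem mem_germSubgroup {X : Type*} [TopologicalSpace X] {μ : X} {h : X ≃ₜ X} :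
    h ∈ germSubgroup μ ↔ ∀ᶠ x in 𝓝 μ, h x = x :=
  Iff.rfl

theorem conj_mem_germSubgroup {X : Type*} [TopologicalSpace X] {μ : X} {h c : X ≃ₜ X}
    (hh : h ∈ germSubgroup μ) (hc : c μ = μ) : c * h * c⁻¹ ∈ germSubgroup μ := by
  have hc' : c.symm μ = μ := c.symm_apply_eq.2 hc.symm
  have ht : Tendsto c.symm (𝓝 μ) (𝓝 μ) := by
    simpa only [hc'] using c.symm.continuous.tendsto μ
  filter_upwards [ht.eventually hh] with x hx
  change c (h (c.symm x)) = x
  rw [hx, c.apply_symm_apply]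

namespace LimitPartition

variable {X ι : Type*} [TopologicalSpace X] (P : LimitPartition X ι)

theorem isClosed_fiber (i : ι) : IsClosed (P.p ⁻¹' {i}) := by
  have : (P.p ⁻¹' {i})ᶜ = ⋃ j : {j // j ≠ i}, P.p ⁻¹' {j.1} := by
    ext x
    simp
  exact ⟨this ▸ isOpen_iUnion fun j => P.isOpen_fiber _⟩

/-- The complement is compact and consists of isolated points. -/
theorem finite_compl_of_isOpen [CompactSpace X] {U : Set X} (hU : IsOpen U)
    (hm : ∀ i, P.m i ∈ U) : Uᶜ.Finite := by
  obtain ⟨t, -, ht⟩ := hU.isClosed_compl.isCompact.elim_nhds_subcover (fun x => {x}) (by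
    intro x hx
    refine (P.isOpen_singleton x fun h => hx ?_).mem_nhds rfl
    rw [h]
    exact hm _)
  refine t.finite_toSet.subset (ht.trans ?_)
  simp

theorem finite_fiber_diff [CompactSpace X] {U : Set X} (hU : IsOpen U) {i : ι}
    (hm : P.m i ∈ U) : {x | P.p x = i ∧ x ∉ U}.Finite := by
  refine (P.finite_compl_of_isOpen (U := U ∪ (P.p ⁻¹' {i})ᶜ)
    (hU.union (P.isClosed_fiber i).isOpen_compl) fun j => ?_).subset ?_
  · by_cases h : j = i
    · exact Or.inl (h ▸ hm)
    · exact Or.inr (by simpa [P.p_m] using h)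
  · rintro x ⟨hx, hxU⟩ (h | h)
    exacts [hxU h, h hx]

/-- Removing a finite, hence closed, set from the open piece leaves a neighbourhood. With
`finite_fiber_diff` this describes all neighbourhoods of `P.m i`. -/
theorem mem_nhds_of_finite_fiber_diff [T1Space X] {W : Set X} {i : ι} (hm : P.m i ∈ W)
    (hW : {x | P.p x = i ∧ x ∉ W}.Finite) : W ∈ 𝓝 (P.m i) := by
  have hopen : IsOpen (P.p ⁻¹' {i} \ {x | P.p x = i ∧ x ∉ W}) :=
    (P.isOpen_fiber i).sdiff hW.isClosed
  refine mem_of_superset (hopen.mem_nhds ⟨P.p_m i, fun h => h.2 hm⟩) ?_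
  rintro x ⟨hx, hn⟩
  by_contra h
  exact hn ⟨hx, h⟩

theorem infinite_fiber_diff_m (i : ι) : {x | P.p x = i ∧ x ≠ P.m i}.Infinite := by
  refine ((P.infinite_fiber i).sdiff (Set.finite_singleton (P.m i))).mono ?_
  rintro x ⟨hx, hn⟩
  exact ⟨hx, hn⟩

/-- A permutation that preserves the pieces and their distinguished points agrees on a given finite
set with a finitary permutation with the same property. -/
theorem exists_finite_approx (σ : Perm X) (hp : ∀ x, P.p (σ x) = P.p x)
    (hm : ∀ i, σ (P.m i) = P.m i) (E : Finset X) :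
    ∃ φ : Perm X, {x | φ x ≠ x}.Finite ∧ (∀ x, P.p (φ x) = P.p x) ∧
      (∀ i, φ (P.m i) = P.m i) ∧ ∀ x ∈ E, φ x = σ x := by
  classical
  induction E using Finset.induction_on with
  | empty => exact ⟨1, by simp, by simp, by simp, by simp⟩
  | insert x E hx ih =>
    obtain ⟨φ, hfin, hφp, hφm, hE⟩ := ih
    -- The swap corrects the value at `x`. It exchanges points of the same piece, neither of which
    -- is a value on `E`.
    refine ⟨swap (φ x) (σ x) * φ, ?_, ?_, ?_, ?_⟩
    · refine (hfin.union ((Set.toFinite {φ x, σ x}).preimage φ.injective.injOn)).subset ?_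
      intro y hy
      by_contra hn
      simp only [Set.mem_union, Set.mem_ofPred_eq, Set.mem_preimage, Set.mem_insert_iff,
        Set.mem_singleton_iff, not_or, not_not] at hn
      refine hy ?_
      rw [Perm.mul_apply, swap_apply_of_ne_of_ne hn.2.1 hn.2.2, hn.1]
    · intro y
      rw [Perm.mul_apply, swap_apply_def]
      split_ifs with h1 h2
      · rw [hp, ← hφp, ← h1, hφp]
      · rw [hφp, ← hp, ← h2, hφp]
      · exact hφp y
    · intro i
      rw [Perm.mul_apply, hφm, swap_apply_def]
      split_ifs with h1 h2
      · rw [← hφm] at h1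
        rw [← φ.injective h1, hm]
      · rw [← hm] at h2
        rw [← σ.injective h2, hφm]
      · rfl
    · intro y hy
      rcases Finset.mem_insert.1 hy with rfl | hy
      · simp
      · have hxy : y ≠ x := fun h => hx (h ▸ hy)
        rw [Perm.mul_apply, swap_apply_of_ne_of_ne (φ.injective.ne hxy), hE y hy]
        rw [hE y hy]
        exact σ.injective.ne hxy

/-- A finite set of isolated points can be moved into a given piece by a finitary permutation. -/
theorem exists_finite_mapsTo_fiber (i : ι) (S : Finset X) (hS : ∀ x ∈ S, ∀ j, x ≠ P.m j) :
    ∃ τ : Perm X, {x | τ x ≠ x}.Finite ∧ (∀ j, τ (P.m j) = P.m j) ∧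
      ∀ x ∈ S, P.p (τ x) = i := by
  classical
  induction S using Finset.induction_on with
  | empty => exact ⟨1, by simp, by simp, by simp⟩
  | insert x S hx ih =>
    obtain ⟨τ, hfin, hτm, hτS⟩ := ih fun y hy => hS y (Finset.mem_insert_of_mem hy)
    obtain ⟨y, ⟨hyi, hym⟩, hyn⟩ := ((P.infinite_fiber_diff_m i).sdiff
      (S.image τ).finite_toSet).nonempty
    refine ⟨swap (τ x) y * τ, ?_, ?_, ?_⟩
    · refine (hfin.union ((Set.toFinite {τ x, y}).preimage τ.injective.injOn)).subset ?_
      intro z hz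
      by_contra hn
      simp only [Set.mem_union, Set.mem_ofPred_eq, Set.mem_preimage, Set.mem_insert_iff,
        Set.mem_singleton_iff, not_or, not_not] at hn
      refine hz ?_
      rw [Perm.mul_apply, swap_apply_of_ne_of_ne hn.2.1 hn.2.2, hn.1]
    · intro j
      rw [Perm.mul_apply, hτm, swap_apply_of_ne_of_ne]
      · rw [← hτm j]
        exact τ.injective.ne (hS x (Finset.mem_insert_self x S) j).symm
      · rintro rfl
        rw [P.p_m] at hyi
        exact hym (by rw [hyi])
    · intro z hz
      rcases Finset.mem_insert.1 hz with rfl | hz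
      · simpa using hyi
      · have hxz : z ≠ x := fun h => hx (h ▸ hz)
        rw [Perm.mul_apply, swap_apply_of_ne_of_ne (τ.injective.ne hxz), hτS z hz]
        rintro rfl
        exact hyn (Finset.mem_coe.2 (Finset.mem_image_of_mem τ hz))

/-- Staying in one's piece is an open condition that holds at all distinguished points. -/
theorem finite_moved_pieces [CompactSpace X] {h : X ≃ₜ X} (hm : ∀ i, h (P.m i) = P.m i) :
    {x | P.p (h x) ≠ P.p x}.Finite := by
  have hopen : IsOpen {x | P.p (h x) = P.p x} := by
    have : {x | P.p (h x) = P.p x} = ⋃ i, (h ⁻¹' (P.p ⁻¹' {i}) ∩ P.p ⁻¹' {i}) := by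
      ext x
      simp [eq_comm]
    rw [this]
    exact isOpen_iUnion fun i => ((P.isOpen_fiber i).preimage h.continuous).inter (P.isOpen_fiber i)
  exact P.finite_compl_of_isOpen hopen fun i => congrArg P.p (hm i)

section Compact

variable [CompactSpace X] [T2Space X]

/-- A permutation that fixes the distinguished points and preserves the pieces up to finitely many
points is a homeomorphism. -/
theorem exists_homeo (σ : Perm X) (hm : ∀ i, σ (P.m i) = P.m i)
    (hp : {x | P.p (σ x) ≠ P.p x}.Finite) : ∃ h : X ≃ₜ X, ∀ x, h x = σ x := by
  have hc : Continuous σ := by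
    refine continuous_iff_continuousAt.2 fun x => ?_
    by_cases hx : x = P.m (P.p x)
    · rw [hx]
      intro W hW
      rw [hm] at hW
      obtain ⟨U, hUW, hU, hmU⟩ := mem_nhds_iff.1 hW
      refine P.mem_nhds_of_finite_fiber_diff (by simpa [hm] using hUW hmU) ?_
      refine (hp.union ((P.finite_fiber_diff hU hmU).preimage σ.injective.injOn)).subset ?_
      rintro y ⟨hy, hyW⟩
      by_cases h : P.p (σ y) = P.p y
      · exact Or.inr ⟨h.trans hy, fun hyU => hyW (hUW hyU)⟩
      · exact Or.inl h
    · have : 𝓝 x = pure x := (isOpen_singleton_iff_nhds_eq_pure x).1 (P.isOpen_singleton x hx)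
      rw [ContinuousAt, this]
      exact tendsto_pure_nhds σ x
  exact ⟨hc.homeoOfEquivCompactToT2, fun x => rfl⟩

/-- Otherwise the open set of moved points would contain almost all of an infinite piece. -/
theorem apply_m_of_finite {h : X ≃ₜ X} (hh : {x | h x ≠ x}.Finite) (i : ι) :
    h (P.m i) = P.m i := by
  by_contra hne
  have hopen : IsOpen {x | h x ≠ x} := isOpen_ne_fun h.continuous continuous_id
  refine P.infinite_fiber i ((hh.union (P.finite_fiber_diff hopen hne)).subset fun x hx => ?_)
  by_cases hxx : x ∈ {x | h x ≠ x}
  exacts [Or.inl hxx, Or.inr ⟨hx, hxx⟩]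

theorem mem_germSubgroup_iff {h : X ≃ₜ X} {i : ι} (hm : h (P.m i) = P.m i) :
    h ∈ germSubgroup (P.m i) ↔ {x | P.p x = i ∧ h x ≠ x}.Finite := by
  constructor
  · intro H
    obtain ⟨U, hU, hUo, hmU⟩ := eventually_nhds_iff.1 (mem_germSubgroup.1 H)
    refine (P.finite_fiber_diff hUo hmU).subset ?_
    rintro x ⟨hx, hne⟩
    exact ⟨hx, fun hxU => hne (hU x hxU)⟩
  · intro H
    exact P.mem_nhds_of_finite_fiber_diff (W := {x | h x = x}) hm H

variable {F : Subgroup (X ≃ₜ X)}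

/-- Evaluation at a point is continuous, so fixing that point is a closed condition. -/
theorem apply_m_of_mem_closure (hF : ∀ h, h ∈ F ↔ {x | h x ≠ x}.Finite) {h : X ≃ₜ X}
    (hh : h ∈ F.topologicalClosure) (i : ι) : h (P.m i) = P.m i := by
  have hev : Continuous fun h : X ≃ₜ X => h (P.m i) :=
    (continuous_eval_const (F := C(X, X)) (P.m i)).comp continuous_homeo_coe
  have hcl : IsClosed {h : X ≃ₜ X | h (P.m i) = P.m i} := isClosed_eq hev continuous_const
  exact hcl.closure_subset_iff.2 (fun φ hφ => P.apply_m_of_finite ((hF φ).1 hφ) i) hh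

/-- Homeomorphisms that preserve the pieces and their distinguished points are limits of finitary
ones. -/
theorem mem_closure_of_preserves [Finite ι] (hF : ∀ h, h ∈ F ↔ {x | h x ≠ x}.Finite)
    {h : X ≃ₜ X} (hp : ∀ x, P.p (h x) = P.p x) (hm : ∀ i, h (P.m i) = P.m i) :
    h ∈ F.topologicalClosure := by
  classical
  have key : ∀ E : Finset X, ∃ φ : X ≃ₜ X, φ ∈ F ∧ (∀ x, P.p (φ x) = P.p x) ∧
      ∀ x, φ x = h x ∨ x ∉ E ∧ φ x ∉ E := by
    intro E
    -- Agreement also on the preimage of `E` prevents any other point from being sent into `E`.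
    obtain ⟨σ, hfin, hσp, hσm, hE⟩ :=
      P.exists_finite_approx h.toEquiv hp hm (E ∪ E.image h.symm)
    obtain ⟨φ, hφ⟩ := P.exists_homeo σ hσm (by simp [hσp])
    refine ⟨φ, (hF φ).2 (by simpa only [hφ] using hfin), by simpa only [hφ] using hσp, ?_⟩
    intro x
    rw [hφ]
    by_cases hx : x ∈ E ∪ E.image h.symm
    · exact Or.inl (hE x hx)
    · refine Or.inr ⟨fun h' => hx (Finset.mem_union_left _ h'), fun h' => hx ?_⟩
      have hmem : h.symm (σ x) ∈ E ∪ E.image h.symm :=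
        Finset.mem_union_right _ (Finset.mem_image_of_mem _ h')
      have := hE _ hmem
      have h2 : σ (h.symm (σ x)) = σ x := this.trans (h.apply_symm_apply _)
      rwa [σ.injective h2] at hmem
  choose φ hφF hφp hφ using key
  have ht : Tendsto φ atTop (𝓝 h) := by
    rw [nhds_induced, tendsto_comap_iff, ContinuousMap.tendsto_nhds_compactOpen]
    intro K hK U hU hKU
    -- These are the only points at which the pieces fail to decide the matter: once `E` contains
    -- them, `φ E` maps `K` into `U`.
    have hQ : {x | (P.m (P.p x) ∈ K ∧ x ∉ U) ∨ (P.m (P.p x) ∉ K ∧ x ∈ K)}.Finite := by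
      have : ∀ i, {x | P.p x = i ∧ ((P.m i ∈ K ∧ x ∉ U) ∨ (P.m i ∉ K ∧ x ∈ K))}.Finite := by
        intro i
        by_cases hi : P.m i ∈ K
        · have hiU : P.m i ∈ U := by simpa [hm] using hKU hi
          refine (P.finite_fiber_diff hU hiU).subset ?_
          rintro x ⟨hx, h | h⟩
          exacts [⟨hx, h.2⟩, absurd hi h.1]
        · refine (P.finite_fiber_diff hK.isClosed.isOpen_compl hi).subset ?_
          rintro x ⟨hx, h | h⟩
          exacts [absurd h.1 hi, ⟨hx, fun h' => h' h.2⟩]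
      refine (Set.finite_iUnion this).subset fun x hx => Set.mem_iUnion.2 ⟨P.p x, rfl, hx⟩
    filter_upwards [eventually_ge_atTop hQ.toFinset] with E hE x hx
    have hE' : ∀ y, ((P.m (P.p y) ∈ K ∧ y ∉ U) ∨ (P.m (P.p y) ∉ K ∧ y ∈ K)) → y ∈ E :=
      fun y hy => hE (hQ.mem_toFinset.2 hy)
    rcases hφ E x with h1 | ⟨h1, h2⟩
    · change φ E x ∈ U
      rw [h1]
      exact hKU hx
    · by_cases hi : P.m (P.p x) ∈ K
      · by_contra hn
        exact h2 (hE' _ (Or.inl ⟨by rwa [hφp], hn⟩))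
      · exact absurd (hE' x (Or.inr ⟨hi, hx⟩)) h1
  exact mem_closure_of_tendsto ht (Eventually.of_forall hφF)

/-- Every limit of finitary homeomorphisms is the product of a finitary one and one that preserves
the pieces. -/
theorem exists_finitary_mul_preserves [Finite ι] {g : X ≃ₜ X} (hg : g ∈ F.topologicalClosure) :
    ∃ φ ∈ F, ∀ x, P.p ((φ⁻¹ * g) x) = P.p x := by
  have hopen : IsOpen {h : X ≃ₜ X | ∀ i, Set.MapsTo (h : C(X, X)) (P.p ⁻¹' {i}) (P.p ⁻¹' {i})} := by
    have : {h : X ≃ₜ X | ∀ i, Set.MapsTo (h : C(X, X)) (P.p ⁻¹' {i}) (P.p ⁻¹' {i})} =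
        ⋂ i, {h : X ≃ₜ X | Set.MapsTo (h : C(X, X)) (P.p ⁻¹' {i}) (P.p ⁻¹' {i})} := by
      ext h
      simp
    rw [this]
    exact isOpen_iInter_of_finite fun i => (ContinuousMap.isOpen_setOfPred_mapsTo
      (P.isClosed_fiber i).isCompact (P.isOpen_fiber i)).preimage continuous_homeo_coe
  have hc : Continuous fun φ : X ≃ₜ X => φ⁻¹ * g := continuous_inv.mul continuous_const
  -- The condition that `φ⁻¹ * g` preserves the pieces is open in `φ` and holds at `φ = g`.
  obtain ⟨φ, hφ, hφF⟩ := mem_closure_iff.1 hg _ (hopen.preimage hc) (by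
    intro i x hx
    simpa using hx)
  exact ⟨φ, hφF, fun x => hφ (P.p x) rfl⟩

end Compact

end LimitPartition

end OrdinalHomeo

/-! ### Normal generation in the closure of the finitary group. -/

namespace OrdinalHomeo

open Equiv Filter Topology

namespace LimitPartition

variable {X ι : Type*} [TopologicalSpace X] (P : LimitPartition X ι)

/-- The isolated points of a piece can be enumerated by the natural numbers. -/
theorem exists_enumeration [Countable X] :
    ∃ e : ι → ℕ → X, (∀ i, Function.Injective (e i)) ∧ (∀ i n, P.p (e i n) = i) ∧
      (∀ i n, e i n ≠ P.m i) ∧ ∀ i x, P.p x = i → x ≠ P.m i → ∃ n, e i n = x := by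
  have h : ∀ i, Nonempty (ℕ ≃ {x | P.p x = i ∧ x ≠ P.m i}) := by
    intro i
    have := (P.infinite_fiber_diff_m i).to_subtype
    exact nonempty_equiv_of_countable
  refine ⟨fun i n => ((h i).some n : X), fun i => Subtype.val_injective.comp (h i).some.injective,
    fun i n => ((h i).some n).2.1, fun i n => ((h i).some n).2.2, fun i x hx hxm => ?_⟩
  obtain ⟨n, hn⟩ := (h i).some.surjective ⟨x, hx, hxm⟩
  exact ⟨n, congrArg Subtype.val hn⟩

variable [CompactSpace X] [T2Space X] [Finite ι] {F : Subgroup (X ≃ₜ X)}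

/-- Families of permutations of `ℕ` act on the isolated points of the pieces by limits of finitary
homeomorphisms, and each such limit that preserves the pieces arises in this way. -/
theorem exists_blockHom (hF : ∀ h, h ∈ F ↔ {x | h x ≠ x}.Finite) {e : ι → ℕ → X}
    (he : ∀ i, Function.Injective (e i)) (hep : ∀ i n, P.p (e i n) = i)
    (hem : ∀ i n, e i n ≠ P.m i) (hes : ∀ i x, P.p x = i → x ≠ P.m i → ∃ n, e i n = x) :
    ∃ Φ : (ι → Perm ℕ) →* F.topologicalClosure,
      (∀ τ i n, (Φ τ).1 (e i n) = e i (τ i n)) ∧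
      ∀ g : F.topologicalClosure, (∀ x, P.p (g.1 x) = P.p x) → ∃ τ, Φ τ = g := by
  classical
  have hcase : ∀ x, (∃ i, x = P.m i) ∨ ∃ i n, x = e i n := by
    intro x
    by_cases hx : x = P.m (P.p x)
    · exact Or.inl ⟨_, hx⟩
    · obtain ⟨n, hn⟩ := hes _ x rfl hx
      exact Or.inr ⟨_, n, hn.symm⟩
  have hne : ∀ i n j, e i n ≠ P.m j := by
    intro i n j h
    have hij : i = j := by rw [← hep i n, h, P.p_m]
    exact hem i n (hij ▸ h)
  let u : (Σ _ : ι, ℕ) ≃ Set.range fun z : Σ _ : ι, ℕ => e z.1 z.2 :=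
    ofInjective (fun z : Σ _ : ι, ℕ => e z.1 z.2) (by
      rintro ⟨i, n⟩ ⟨j, k⟩ h
      obtain rfl : i = j := by
        have := congrArg P.p h
        simpa [hep] using this
      exact congrArg (Sigma.mk i) (he i h))
  have hext : ∀ τ : ι → Perm ℕ, ∃ g : F.topologicalClosure,
      (∀ i n, g.1 (e i n) = e i (τ i n)) := by
    intro τ
    let σ : Perm X := Perm.extendDomain (sigmaCongrRight τ) u
    have hσe : ∀ i n, σ (e i n) = e i (τ i n) := fun i n =>
      Perm.extendDomain_apply_image (sigmaCongrRight τ) u ⟨i, n⟩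
    have hσm : ∀ i, σ (P.m i) = P.m i := fun i =>
      Perm.extendDomain_apply_not_subtype _ _ (by
        rintro ⟨⟨j, n⟩, h⟩
        exact hne _ _ _ h)
    have hσp : ∀ x, P.p (σ x) = P.p x := by
      intro x
      rcases hcase x with ⟨i, rfl⟩ | ⟨i, n, rfl⟩
      · rw [hσm]
      · rw [hσe, hep, hep]
    obtain ⟨h, hh⟩ := P.exists_homeo σ hσm (by simp [hσp])
    exact ⟨⟨h, P.mem_closure_of_preserves hF (by simpa only [hh] using hσp)
      (by simpa only [hh] using hσm)⟩, fun i n => (hh _).trans (hσe i n)⟩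
  have heq : ∀ g g' : F.topologicalClosure, (∀ i n, g.1 (e i n) = g'.1 (e i n)) → g = g' := by
    intro g g' h
    ext x
    rcases hcase x with ⟨i, rfl⟩ | ⟨i, n, rfl⟩
    · rw [P.apply_m_of_mem_closure hF g.2, P.apply_m_of_mem_closure hF g'.2]
    · exact h i n
  choose Φ hΦ using hext
  refine ⟨MonoidHom.mk' Φ fun a b => heq _ _ fun i n => ?_, hΦ, fun g hg => ?_⟩
  · change _ = (Φ a).1 ((Φ b).1 (e i n))
    rw [hΦ, hΦ, hΦ]
    rfl
  · have hgm := P.apply_m_of_mem_closure hF g.2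
    have hgm' := P.apply_m_of_mem_closure hF (g⁻¹).2
    have hgg : ∀ x, g.1 ((g⁻¹).1 x) = x := fun x => g.1.apply_symm_apply x
    have hgg' : ∀ x, (g⁻¹).1 (g.1 x) = x := fun x => g.1.symm_apply_apply x
    have h1 : ∀ i n, ∃ k, e i k = g.1 (e i n) := fun i n =>
      hes i _ (by rw [hg, hep]) fun h => hem i n (g.1.injective (h.trans (hgm i).symm))
    have h2 : ∀ i n, ∃ k, e i k = (g⁻¹).1 (e i n) := fun i n =>
      hes i _ (by rw [← hg, hgg, hep]) fun h =>
        hem i n ((g⁻¹).1.injective (h.trans (hgm' i).symm))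
    choose a ha using h1
    choose b hb using h2
    refine ⟨fun i => ⟨a i, b i, fun n => he i ?_, fun n => he i ?_⟩, heq _ _ fun i n => ?_⟩
    · rw [hb, ha, hgg']
    · rw [ha, hb, hgg]
    · exact (hΦ _ i n).trans (ha i n)

/-- A limit of finitary homeomorphisms that moves infinitely many points of each piece normally
generates with words of length at most `16`. -/
theorem isConjWord_of_infinite [Nonempty ι] [Countable X]
    (hF : ∀ h, h ∈ F ↔ {x | h x ≠ x}.Finite) (f : F.topologicalClosure)
    (hf : ∀ i, {x | P.p x = i ∧ f.1 x ≠ x}.Infinite) (g : F.topologicalClosure) :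
    IsConjWord f 16 g := by
  classical
  obtain ⟨e, he, hep, hem, hes⟩ := P.exists_enumeration
  obtain ⟨Φ, hΦ, hsurj⟩ := P.exists_blockHom hF he hep hem hes
  have hfm := P.apply_m_of_mem_closure hF f.2
  have hY : ∀ i, ∃ Y : Set X, Y.Infinite ∧ (∀ x ∈ Y, P.p x = i ∧ P.p (f.1 x) = i ∧ x ≠ P.m i) ∧
      ∀ x ∈ Y, f.1 x ∉ Y := by
    intro i
    -- Points leaving their piece are discarded, so that the image of `Y i` cannot meet another `Y
    -- j`.
    obtain ⟨Y, hYD, hYi, hYd⟩ := exists_infinite_subset_disjoint_image f.1.injective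
      ((hf i).sdiff (P.finite_moved_pieces hfm)) fun x hx => hx.1.2
    refine ⟨Y, hYi, fun x hx => ?_, hYd⟩
    obtain ⟨⟨h1, h2⟩, h3⟩ := hYD hx
    refine ⟨h1, (not_not.1 h3).trans h1, ?_⟩
    rintro rfl
    exact h2 (hfm i)
  choose Y hYi hYp hYd using hY
  have hNi : ∀ i, (e i ⁻¹' Y i).Infinite := by
    intro i
    refine (hYi i).preimage fun x hx => ?_
    exact hes i x (hYp i x hx).1 (hYp i x hx).2.2
  have hsupp : ∀ τ : ι → Perm ℕ, (∀ i, ∀ n ∉ e i ⁻¹' Y i, τ i n = n) →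
      ∀ x, x ∉ Y (P.p x) → (Φ τ).1 x = x := by
    intro τ hτ x hx
    by_cases hxm : x = P.m (P.p x)
    · rw [hxm]
      exact P.apply_m_of_mem_closure hF (Φ τ).2 _
    · obtain ⟨n, hn⟩ := hes _ x rfl hxm
      rw [← hn, hΦ, hτ]
      rwa [Set.mem_preimage, hn]
  have hcomm : ∀ t s : ι → Perm ℕ, (∀ i, ∀ n ∉ e i ⁻¹' Y i, t i n = n) →
      (∀ i, ∀ n ∉ e i ⁻¹' Y i, s i n = n) → Commute (f * Φ t * f⁻¹) (Φ s) := by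
    intro t s ht hs
    have hdisj : Perm.Disjoint (f * Φ t * f⁻¹).1.toEquiv (Φ s).1.toEquiv := by
      intro x
      by_cases hx : x ∈ Y (P.p x)
      · left
        change f.1 ((Φ t).1 (f.1.symm x)) = x
        rw [hsupp t ht, f.1.apply_symm_apply]
        intro hmem
        have h1 := (hYp _ _ hmem).2.1
        rw [f.1.apply_symm_apply] at h1
        rw [← h1] at hmem
        exact hYd _ _ hmem (by rwa [f.1.apply_symm_apply])
      · exact Or.inr (hsupp s hs x hx)
    ext x
    exact congrArg (fun σ : Perm X => σ x) hdisj.commute.eq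
  have hblock : ∀ g : F.topologicalClosure, (∀ x, P.p (g.1 x) = P.p x) → IsConjWord f 8 g := by
    intro g hg
    obtain ⟨σ, rfl⟩ := hsurj g hg
    -- The choices are made for all pieces simultaneously, so the length 4 + 4 does not grow with
    -- their number.
    choose c t s c' t' s' ht hs ht' hs' h using fun i => exists_mul_conj_commutator (hNi i) (σ i)
    have hσ : σ = c * (t⁻¹ * s * t * s⁻¹) * c⁻¹ * (c' * (t'⁻¹ * s' * t' * s'⁻¹) * c'⁻¹) :=
      funext h
    rw [hσ]
    simp only [map_mul, map_inv]
    exact ((isConjWord_commutator (hcomm t t ht ht) (hcomm t s ht hs)).conj _).mul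
      ((isConjWord_commutator (hcomm t' t' ht' ht') (hcomm t' s' ht' hs')).conj _)
  obtain ⟨φ, hφ, hv⟩ := P.exists_finitary_mul_preserves g.2
  have hφfin := (hF φ).1 hφ
  obtain ⟨i⟩ := ‹Nonempty ι›
  -- Conjugation moves the support of `φ` into one piece, which makes the conjugate
  -- piece-preserving.
  obtain ⟨σ, hσfin, hσm, hσS⟩ := P.exists_finite_mapsTo_fiber i hφfin.toFinset (by
    rintro x hx j rfl
    exact (hφfin.mem_toFinset.1 hx) (P.apply_m_of_finite hφfin j))
  obtain ⟨τ, hτ⟩ := P.exists_homeo σ hσm (hσfin.subset fun x hx h => hx (by rw [h]))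
  have hτF : τ ∈ F := (hF τ).2 (by simpa only [hτ] using hσfin)
  have hFc := F.le_topologicalClosure
  let φ' : F.topologicalClosure := ⟨φ, hFc hφ⟩
  let τ' : F.topologicalClosure := ⟨τ, hFc hτF⟩
  have hw : IsConjWord f 8 (τ' * φ' * τ'⁻¹) := by
    refine hblock _ fun x => ?_
    change P.p (τ (φ (τ.symm x))) = P.p x
    by_cases hx : φ (τ.symm x) = τ.symm x
    · rw [hx, τ.apply_symm_apply]
    · have h1 : P.p (τ (τ.symm x)) = i := by
        rw [hτ]
        exact hσS _ (hφfin.mem_toFinset.2 hx)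
      have h2 : P.p (τ (φ (τ.symm x))) = i := by
        rw [hτ]
        exact hσS _ (hφfin.mem_toFinset.2 fun h => hx (φ.injective h))
      rw [h2, ← h1, τ.apply_symm_apply]
  have hg : g = τ'⁻¹ * (τ' * φ' * τ'⁻¹) * τ'⁻¹⁻¹ * (φ'⁻¹ * g) := by group
  rw [hg]
  exact (hw.conj τ'⁻¹).mul (hblock _ hv)

/-- A normal generator has nontrivial germs at all distinguished points. -/
theorem notMem_germSubgroup_of_isNormalGenerator [Countable X]
    (hF : ∀ h, h ∈ F ↔ {x | h x ≠ x}.Finite) {f : F.topologicalClosure}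
    (hf : IsNormalGenerator f) (i : ι) : f.1 ∉ germSubgroup (P.m i) := by
  intro hgerm
  have hall : ∀ g : F.topologicalClosure, g.1 ∈ germSubgroup (P.m i) := by
    intro g
    obtain ⟨l, hl, rfl⟩ := hf g
    refine Subgroup.list_prod_mem ((germSubgroup (P.m i)).comap F.topologicalClosure.subtype) ?_
    intro y hy
    rcases hl y hy with h | h
    · obtain ⟨c, rfl⟩ := isConj_iff.1 h
      exact conj_mem_germSubgroup hgerm (P.apply_m_of_mem_closure hF c.2 i)
    · obtain ⟨c, rfl⟩ := isConj_iff.1 h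
      exact conj_mem_germSubgroup (inv_mem hgerm) (P.apply_m_of_mem_closure hF c.2 i)
  obtain ⟨e, he, hep, hem, hes⟩ := P.exists_enumeration
  obtain ⟨Φ, hΦ, -⟩ := P.exists_blockHom hF he hep hem hes
  -- Translation by `1` on `ℤ`, transported to `ℕ`, has no fixed point, so its germ at `P.m i` is
  -- nontrivial.
  let τ : ι → Perm ℕ := fun _ => (Equiv.intEquivNat.symm.trans (Equiv.addRight 1)).trans
    Equiv.intEquivNat
  refine Set.infinite_range_of_injective (he i)
    (((P.mem_germSubgroup_iff (P.apply_m_of_mem_closure hF (Φ τ).2 i)).1 (hall (Φ τ))).subset ?_)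
  rintro _ ⟨n, rfl⟩
  refine ⟨hep i n, ?_⟩
  rw [hΦ]
  refine (he i).ne fun h => ?_
  have := congrArg Equiv.intEquivNat.symm h
  simp [τ] at this

end LimitPartition

end OrdinalHomeo

/-! ### The ordinal `ω·d + 1` and its partition into blocks. -/

namespace OrdinalHomeo

open Equiv Filter Topology
open scoped Ordinal

theorem omega_mul_add_one (k : ℕ) : ω * ((k + 1 : ℕ) : Ordinal.{0}) = ω * k + ω := by
  push_cast
  rw [mul_add_one]

theorem omega_mul_lt {j k : ℕ} (h : j < k) : ω * (j : Ordinal.{0}) < ω * k :=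
  mul_lt_mul_of_pos_left (by exact_mod_cast h) Ordinal.omega0_pos

theorem omega_mul_le {j k : ℕ} (h : j ≤ k) : ω * (j : Ordinal.{0}) ≤ ω * k :=
  mul_le_mul_right (by exact_mod_cast h) _

theorem omega_mul_add_lt (k l : ℕ) :
    ω * (k : Ordinal.{0}) + l < ω * ((k + 1 : ℕ) : Ordinal.{0}) := by
  rw [omega_mul_add_one]
  exact (add_lt_add_iff_left _).2 (Ordinal.natCast_lt_omega0 l)

variable {d : ℕ}

theorem mem_Iio_omega_mul {x : Ordinal.{0}} :
    x ∈ Set.Iio (ω * (d : Ordinal.{0}) + 1) ↔ x ≤ ω * d := by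
  rw [Set.mem_Iio, ← Order.succ_eq_add_one, Order.lt_succ_iff]

/-- Every point is `0`, of maximal rank, or in a block. -/
theorem space_cases (x : Space d) : x.1 = 0 ∨ (∃ k < d, x.1 = ω * ((k + 1 : ℕ) : Ordinal.{0})) ∨
    ∃ k < d, x ∈ block d k := by
  have hx : x.1 ≤ ω * d := mem_Iio_omega_mul.1 x.2
  have h1 : x.1 / ω < ω := by
    refine lt_of_le_of_lt (Ordinal.div_le_of_le_mul hx) (Ordinal.natCast_lt_omega0 d)
  have h2 : x.1 % ω < ω := Ordinal.mod_lt _ Ordinal.omega0_ne_zero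
  obtain ⟨a, ha⟩ := Ordinal.lt_omega0.1 h1
  obtain ⟨b, hb⟩ := Ordinal.lt_omega0.1 h2
  have hab : x.1 = ω * a + b := by rw [← ha, ← hb, Ordinal.div_add_mod]
  rcases Nat.eq_zero_or_pos b with rfl | hb0
  · rcases a with _ | a
    · left
      simpa using hab
    · right; left
      refine ⟨a, ?_, by simpa using hab⟩
      by_contra hn
      have := omega_mul_lt (show d < a + 1 by omega)
      rw [hab] at hx
      simp only [Nat.cast_zero, add_zero] at hx
      exact absurd hx (not_le.2 this)
  · right; right
    refine ⟨a, ?_, b, hb0, hab⟩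
    by_contra hn
    have h3 := omega_mul_le (not_lt.1 hn)
    have h4 : ω * (a : Ordinal.{0}) < ω * a + b := by
      simpa using hb0
    rw [hab] at hx
    exact absurd (hx.trans h3) (not_le.2 h4)

theorem exists_piece (hd : 1 ≤ d) (x : Space d) :
    ∃ k : Fin d, x.1 ≤ ω * ((k.1 + 1 : ℕ) : Ordinal.{0}) ∧
      (k.1 = 0 ∨ ω * (k.1 : Ordinal.{0}) < x.1) := by
  rcases space_cases x with h | ⟨k, hk, h⟩ | ⟨k, hk, l, hl, h⟩
  · exact ⟨⟨0, hd⟩, by simp [h], Or.inl rfl⟩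
  · exact ⟨⟨k, hk⟩, h.le, Or.inr (h ▸ omega_mul_lt (Nat.lt_succ_self k))⟩
  · refine ⟨⟨k, hk⟩, h ▸ (omega_mul_add_lt k l).le, Or.inr ?_⟩
    rw [h]
    simpa using Nat.pos_of_ne_zero (Nat.one_le_iff_ne_zero.1 hl)

theorem piece_unique {x : Ordinal.{0}} {j k : ℕ} (hj : x ≤ ω * ((j + 1 : ℕ) : Ordinal.{0}))
    (hk : k = 0 ∨ ω * (k : Ordinal.{0}) < x) : k ≤ j := by
  rcases hk with rfl | hk
  · exact Nat.zero_le j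
  · by_contra hn
    exact absurd (hj.trans (omega_mul_le (not_le.1 hn))) (not_le.2 hk)

/-- The `k` such that the point lies in `[ω·k + 1, ω·(k + 1)]`; the point `0` has `k = 0`. -/
noncomputable def piece (hd : 1 ≤ d) (x : Space d) : Fin d :=
  (exists_piece hd x).choose

theorem piece_eq_iff (hd : 1 ≤ d) {x : Space d} {k : Fin d} :
    piece hd x = k ↔ x.1 ≤ ω * ((k.1 + 1 : ℕ) : Ordinal.{0}) ∧
      (k.1 = 0 ∨ ω * (k.1 : Ordinal.{0}) < x.1) := by
  have h := (exists_piece hd x).choose_spec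
  constructor
  · rintro rfl
    exact h
  · intro hk
    exact Fin.ext (le_antisymm (piece_unique hk.1 h.2) (piece_unique h.1 hk.2))

/-- The point `ω·(k + 1)`. -/
noncomputable def limitPoint (k : Fin d) : Space d :=
  ⟨ω * ((k.1 + 1 : ℕ) : Ordinal.{0}), mem_Iio_omega_mul.2 (omega_mul_le k.2)⟩

theorem piece_limitPoint (hd : 1 ≤ d) (k : Fin d) : piece hd (limitPoint k) = k :=
  (piece_eq_iff hd).2 ⟨le_rfl, Or.inr (omega_mul_lt (Nat.lt_succ_self _))⟩

theorem piece_of_mem_block (hd : 1 ≤ d) {k : Fin d} {x : Space d} (hx : x ∈ block d k) :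
    piece hd x = k := by
  obtain ⟨l, hl, h⟩ := hx
  refine (piece_eq_iff hd).2 ⟨h ▸ (omega_mul_add_lt k l).le, Or.inr ?_⟩
  rw [h]
  simpa using Nat.pos_of_ne_zero (Nat.one_le_iff_ne_zero.1 hl)

/-- The points that belong to no block. -/
def exceptional (d : ℕ) : Set (Space d) :=
  {x | x.1 = 0 ∨ ∃ k : Fin d, x = limitPoint k}

theorem finite_exceptional : (exceptional d).Finite := by
  have h : (Subtype.val ⁻¹' {0} : Set (Space d)).Finite :=
    (Set.finite_singleton _).preimage Subtype.val_injective.injOn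
  refine (h.union (Set.finite_range (limitPoint (d := d)))).subset ?_
  rintro x (hx | ⟨k, rfl⟩)
  exacts [Or.inl hx, Or.inr ⟨k, rfl⟩]

theorem mem_exceptional_or_mem_block (hd : 1 ≤ d) (x : Space d) :
    x ∈ exceptional d ∨ x ∈ block d (piece hd x) := by
  rcases space_cases x with h | ⟨k, hk, h⟩ | ⟨k, hk, h⟩
  · exact Or.inl (Or.inl h)
  · exact Or.inl (Or.inr ⟨⟨k, hk⟩, Subtype.ext h⟩)
  · right
    rwa [piece_of_mem_block (k := ⟨k, hk⟩) hd h]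

theorem infinite_block (k : Fin d) : (block d k).Infinite := by
  let u : ℕ → Space d := fun l => ⟨ω * k.1 + ((l + 1 : ℕ) : Ordinal.{0}),
    mem_Iio_omega_mul.2 ((omega_mul_add_lt k (l + 1)).le.trans (omega_mul_le k.2))⟩
  have hu : Function.Injective u := by
    intro a b h
    have h' := congrArg Subtype.val h
    simp only [u, add_right_inj] at h'
    have : a + 1 = b + 1 := by exact_mod_cast h'
    omega
  refine (Set.infinite_range_of_injective hu).mono ?_
  rintro _ ⟨l, rfl⟩
  exact ⟨l + 1, by omega, rfl⟩

/-- In the order topology the non-limit ordinals are isolated; `0` does not count as a limit, being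
minimal. -/
theorem isOpen_singleton_of_notMem_range {x : Space d} (hx : ∀ k, x ≠ limitPoint k) :
    IsOpen {x} := by
  have hlim : ¬ Order.IsSuccLimit x.1 := by
    rcases space_cases x with h | ⟨k, hk, h⟩ | ⟨k, hk, l, hl, h⟩
    · rw [h]
      exact fun h0 => h0.1 isMin_bot
    · exact absurd (Subtype.ext h) (hx ⟨k, hk⟩)
    · obtain ⟨l, rfl⟩ := Nat.exists_eq_add_of_le' hl
      rw [h]
      push_cast
      rw [← add_assoc, ← Order.succ_eq_add_one]
      exact Order.not_isSuccLimit_succ _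
  have := (SuccOrder.isOpen_singleton_iff.2 hlim).preimage
    (continuous_subtype_val (p := fun y => y ∈ Set.Iio (ω * (d : Ordinal.{0}) + 1)))
  convert this using 1
  ext y
  simp [Subtype.ext_iff]

/-- The partition of `ω·d + 1` into the blocks with their limit points. -/
noncomputable def blockPartition (hd : 1 ≤ d) : LimitPartition (Space d) (Fin d) where
  p := piece hd
  m := limitPoint
  p_m := piece_limitPoint hd
  isOpen_fiber k := by
    have h : piece hd ⁻¹' {k} = Subtype.val ⁻¹'
        (Set.Iio (Order.succ (ω * ((k.1 + 1 : ℕ) : Ordinal.{0}))) ∩ {x | k.1 = 0 ∨ ω * (k.1 : Ordinal.{0}) < x}) := by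
      ext x
      simp [piece_eq_iff]
    rw [h]
    refine (isOpen_Iio.inter ?_).preimage continuous_subtype_val
    by_cases hk : k.1 = 0
    · simp [hk]
    · simp only [hk, false_or]
      exact isOpen_Ioi
  isOpen_singleton x hx := isOpen_singleton_of_notMem_range (by
    rintro k rfl
    exact hx (by rw [piece_limitPoint]))
  infinite_fiber k := (infinite_block k).mono fun x hx => piece_of_mem_block hd hx

theorem countable_space (hd : 1 ≤ d) : Countable (Space d) := by
  have h : (Set.univ : Set (Space d)) ⊆ exceptional d ∪ ⋃ k : Fin d, block d k := by
    intro x _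
    rcases mem_exceptional_or_mem_block hd x with h | h
    exacts [Or.inl h, Or.inr (Set.mem_iUnion.2 ⟨_, h⟩)]
  refine Set.countable_univ_iff.1 ((finite_exceptional.countable.union
    (Set.countable_iUnion fun k => ?_)).mono h)
  have hb : block d k ⊆ ⋃ l : ℕ, {x : Space d | x.1 = ω * (k.1 : Ordinal.{0}) + l} := by
    rintro x ⟨l, -, hx⟩
    exact Set.mem_iUnion.2 ⟨l, hx⟩
  refine (Set.countable_iUnion fun l => Set.Subsingleton.countable ?_).mono hb
  intro x hx y hy
  exact Subtype.ext (Eq.trans hx (Eq.symm hy))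

/-- Only the finitely many exceptional points lie outside the blocks. -/
theorem mem_finitary_iff (hd : 1 ≤ d) (h : Space d ≃ₜ Space d) :
    h ∈ finitary d ↔ {x | h x ≠ x}.Finite := by
  constructor
  · intro hh
    refine (finite_exceptional.union hh).subset fun x hx => ?_
    rcases mem_exceptional_or_mem_block hd x with hxe | hxb
    · exact Or.inl hxe
    · exact Or.inr ⟨Set.mem_biUnion (piece hd x).2 hxb, hx⟩
  · intro hh
    exact hh.subset fun x hx => hx.2

theorem mem_maxRank_iff {x : Space d} : x ∈ maxRank d ↔ ∃ k, x = limitPoint k := by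
  constructor
  · rintro ⟨k, h1, h2, h⟩
    obtain ⟨k, rfl⟩ := Nat.exists_eq_add_of_le' h1
    exact ⟨⟨k, h2⟩, Subtype.ext h⟩
  · rintro ⟨k, rfl⟩
    exact ⟨k + 1, by omega, k.2, rfl⟩

/-- Trivial germs at a point form a subgroup, so only the generator needs testing. -/
theorem trivialGermSet_zpowers_eq_empty_iff (f : finitaryClosure d) :
    trivialGermSet (Subgroup.zpowers f) = ∅ ↔ ∀ k : Fin d, f.1 ∉ germSubgroup (limitPoint k) := by
  have hgerm : ∀ (g : Space d ≃ₜ Space d) μ, (∃ U : Set (Space d), IsOpen U ∧ μ ∈ U ∧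
      ∀ x ∈ U, g x = x) ↔ g ∈ germSubgroup μ := by
    intro g μ
    rw [mem_germSubgroup, eventually_nhds_iff]
    exact exists_congr fun U => ⟨fun h => ⟨h.2.2, h.1, h.2.1⟩, fun h => ⟨h.2.1, h.2.2, h.1⟩⟩
  rw [Set.eq_empty_iff_forall_notMem]
  constructor
  · intro H k hk
    refine H (limitPoint k) ⟨mem_maxRank_iff.2 ⟨k, rfl⟩, fun g hg => (hgerm _ _).2 ?_⟩
    have : Subgroup.zpowers f ≤ (germSubgroup (limitPoint k)).comap (finitaryClosure d).subtype :=
      Subgroup.zpowers_le.2 hk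
    exact this hg
  · rintro H μ ⟨hμ, h⟩
    obtain ⟨k, rfl⟩ := mem_maxRank_iff.1 hμ
    exact H k ((hgerm _ _).1 (h f (Subgroup.mem_zpowers f)))

/-- The almost-invariance of the block is automatic: `f` moves only finitely many points between
pieces, and block and piece differ by exceptional points. -/
theorem inducesInfinitePerm_block_iff (hd : 1 ≤ d) (f : finitaryClosure d) (k : Fin d) :
    InducesInfinitePerm f.1 (block d k) ↔ {x | piece hd x = k ∧ f.1 x ≠ x}.Infinite := by
  have hmoved : {x | piece hd (f.1 x) ≠ piece hd x}.Finite :=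
    (blockPartition hd).finite_moved_pieces
      ((blockPartition hd).apply_m_of_mem_closure (mem_finitary_iff hd) f.2)
  have hblock : ∀ x, piece hd x = k → x ∉ exceptional d → x ∈ block d k := by
    rintro x rfl hx
    exact (mem_exceptional_or_mem_block hd x).resolve_left hx
  have hsymm : (symmDiff (f.1 '' block d k) (block d k)).Finite := by
    refine (((hmoved.union finite_exceptional).image f.1).union finite_exceptional).subset ?_
    rintro y (⟨⟨x, hx, rfl⟩, hy⟩ | ⟨hy, hyn⟩)
    · by_cases h : piece hd (f.1 x) = piece hd x
      · right
        by_contra hn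
        exact hy (hblock _ (h.trans (piece_of_mem_block hd hx)) hn)
      · exact Or.inl ⟨x, Or.inl h, rfl⟩
    · obtain ⟨x, rfl⟩ := f.1.surjective y
      left
      refine ⟨x, ?_, rfl⟩
      by_contra hn
      rw [Set.mem_union, not_or] at hn
      refine hyn ⟨x, hblock x ?_ hn.2, rfl⟩
      rw [← not_not.1 hn.1, piece_of_mem_block hd hy]
  constructor
  · intro h
    exact h.2.mono fun x hx => ⟨piece_of_mem_block hd hx.1, hx.2⟩
  · intro h
    refine ⟨hsymm, (h.sdiff finite_exceptional).mono ?_⟩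
    rintro x ⟨⟨hx, hne⟩, hn⟩
    exact ⟨hblock x hx hn, hne⟩

end OrdinalHomeo

theorem mainTheorem10 (d : ℕ) (hd : 1 ≤ d) (f : OrdinalHomeo.finitaryClosure d) :
    List.TFAE
      [OrdinalHomeo.IsNormalGenerator f,
        OrdinalHomeo.IsUniformNormalGenerator f,
        OrdinalHomeo.trivialGermSet (Subgroup.zpowers f) = ∅,
        ∀ k < d, OrdinalHomeo.InducesInfinitePerm f.1 (OrdinalHomeo.block d k)] := by
  have hF := OrdinalHomeo.mem_finitary_iff hd
  have : Countable (OrdinalHomeo.Space d) := OrdinalHomeo.countable_space hd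
  have : Nonempty (Fin d) := ⟨⟨0, hd⟩⟩
  tfae_have 2 → 1 := by
    rintro ⟨n, -, h⟩ x
    obtain ⟨l, -, hl⟩ := h x
    exact ⟨l, hl⟩
  tfae_have 1 → 3 := by
    intro h
    exact (OrdinalHomeo.trivialGermSet_zpowers_eq_empty_iff f).2
      ((OrdinalHomeo.blockPartition hd).notMem_germSubgroup_of_isNormalGenerator hF h)
  tfae_have 3 → 4 := by
    intro h k hk
    have hk' := (OrdinalHomeo.trivialGermSet_zpowers_eq_empty_iff f).1 h ⟨k, hk⟩
    refine (OrdinalHomeo.inducesInfinitePerm_block_iff hd f ⟨k, hk⟩).2 fun hfin => hk' ?_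
    exact ((OrdinalHomeo.blockPartition hd).mem_germSubgroup_iff
      ((OrdinalHomeo.blockPartition hd).apply_m_of_mem_closure hF f.2 ⟨k, hk⟩)).2 hfin
  tfae_have 4 → 2 := by
    intro h
    exact ⟨16, by norm_num, (OrdinalHomeo.blockPartition hd).isConjWord_of_infinite hF f
      fun k => (OrdinalHomeo.inducesInfinitePerm_block_iff hd f k).1 (h k k.2)⟩
  tfae_finish
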